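/- Let $F\in\mathbb{R}[x,y,z]$ be square-free with no nonconstant factor depending only on $z$, and assume that, if $\deg_y F>0$, the leading coefficient of $F$ with respect to $y$ does not depend on $x$. Let $S=\{F=0\}$, and for $a\in\mathbb{R}$ let $S_a$ be the level curve $S\cap\{z=a\}$. For a polynomial $G$ and a variable $w$ put $D_w(G)=\mathrm{Res}_w(G,\partial G/\partial w)$, and let $\sqrt G$ denote the square-free part of $G$. Set $$M(x,z)=\begin{cases}0&\text{if }\deg_y F=0,\\ \sqrt{D_y(F)}&\text{otherwise,}\end{cases}\qquad R(z)=\begin{cases}0&\text{if }\deg_x M=0,\\ D_x(M)&\text{otherwise,}\end{cases}$$ and let $\mathcal{A}\subset\mathbb{R}$ be the set of real roots of $R(z)$ if $R\not\equiv 0$; the set of real roots of $D_x(F)$ (a polynomial in $z$) if $R\equiv 0$ and $M\equiv 0$; the set of real roots of $M$ (then a polynomial in $z$) if $R\equiv 0$ and $M\not\equiv 0$. Call $S$ real if $S\cap\mathbb{R}^3$ has dimension two, and call $S_a$ real if its set of real points $S_a\cap\mathbb{R}^3$ has dimension one. Then $S$ is real if and only if there is some $a\in\mathbb{R}\setminus\mathcal{A}$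 such that the level curve $S_a$ is real. -/

import Mathlib

open Polynomial

namespace LevelCurves

noncomputable section

/-- Polynomials in `x, y, z` with real coefficients, written as `ℝ[z][x][y]`: the outermost variable
is `y`, the middle one is `x`, the innermost one is `z`. In particular `natDegree` and
`leadingCoeff` of such a polynomial are the degree and the leading coefficient with respect
to `y`, the latter being an element of `ℝ[z][x]`. -/
abbrev Poly3 : Type := ℝ[X][X][X]

/-- The value `F(x, y, z)`. -/
def value (F : Poly3) (x y z : ℝ) : ℝ :=
  ((F.eval (C (C y))).eval (C x)).eval z

/-- The real part `S ∩ ℝ³` of the surface `S = {F = 0}`; a point has coordinates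
`(p 0, p 1, p 2) = (x, y, z)`. -/
def surface (F : Poly3) : Set (EuclideanSpace ℝ (Fin 3)) :=
  {p | value F (p 0) (p 1) (p 2) = 0}

/-- The real part of the level curve `S_a`, the section of `S` with the plane `z = a`. -/
def levelCurve (F : Poly3) (a : ℝ) : Set (EuclideanSpace ℝ (Fin 3)) :=
  {p | p ∈ surface F ∧ p 2 = a}

/-- The surface `S = {F = 0}` is real: `S ∩ ℝ³` has dimension two. The dimension of a subset of
Euclidean space is its Hausdorff dimension, which on real algebraic sets agrees with the topological
and with the semialgebraic dimension. -/
def IsRealSurface (F : Poly3) : Prop := dimH (surface F) = 2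

/-- The level curve `S_a` is real: its real part has dimension one. -/
def IsRealLevelCurve (F : Poly3) (a : ℝ) : Prop := dimH (levelCurve F a) = 1

/-- The discriminant `D_w(G) = Res_w(G, ∂G/∂w)`, where `w` is the (outermost) variable of `G`. -/
def disc {A : Type*} [CommRing A] (G : A[X]) : A :=
  G.resultant (derivative G)

/-- `M(x, z) ∈ ℝ[z][x]`: zero if `deg_y F = 0`, otherwise the square-free part of `D_y(F)`. -/
def polyM (F : Poly3) : ℝ[X][X] :=
  open Classical in
  if F.natDegree = 0 then 0 else UniqueFactorizationMonoid.radical (disc F)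

/-- `R(z) ∈ ℝ[z]`: zero if `deg_x M = 0`, otherwise `D_x(M)`. -/
def polyR (F : Poly3) : ℝ[X] :=
  open Classical in
  if (polyM F).natDegree = 0 then 0 else disc (polyM F)

/-- The critical level set computed from `F`:
the real roots of `R`, if `R` is not identically zero;
the real roots of `D_x(F)`, if `R` and `M` are identically zero (then `F` is a polynomial in `x, z`,
namely its coefficient of `y ^ 0`);
the real roots of `M`, if `R` is identically zero and `M` is not (then `M` is a polynomial in `z`,
namely its coefficient of `x ^ 0`). -/
def criticalSet (F : Poly3) : Set ℝ :=
  open Classical in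
  if polyR F ≠ 0 then {a | (polyR F).IsRoot a}
  else if polyM F = 0 then {a | (disc (F.coeff 0)).IsRoot a}
  else {a | ((polyM F).coeff 0).IsRoot a}

end

end LevelCurves

namespace LevelCurves

open Filter Topology Set MeasureTheory

/-! ### Discriminants over factorial rings and their specialisations. -/

section Discriminant

variable {A : Type*} [CommRing A]

/-! Let deg_y F > 0. Where M(x, a) ≠ 0, all roots of F(x, ·, a) are simple, so by the implicit
function theorem S_a is locally a graph over an x-interval and S over an open set of the (x,
z)-plane: both are real. For a ∉ 𝒜 neither M(·, a) nor any F(x, ·, a) vanishes identically, so only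
finitely many points of S_a lie over M = 0. All such points together have dimension at most one
(`dimH_eval₂_le_image_fst`, `dimH_planeCurve_le`), as do the finitely many critical levels. Hence
either kind of reality forces a point with M ≠ 0 (`isRealSurface_iff_of_generic`).

If deg_y F = 0, a point of S_a brings a whole line with it, and off 𝒜 the equation is solved for x
instead (`isRealSurface_iff_of_cylinder`). -/

theorem squarefree_map_fractionRing [IsDomain A] [UniqueFactorizationMonoid A] {f : A[X]}
    (hf : Squarefree f) : Squarefree (f.map (algebraMap A (FractionRing A))) := by
  classical
  obtain ⟨_⟩ : Nonempty (NormalizedGCDMonoid A) := inferInstance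
  set K := FractionRing A
  have hf0 : f.map (algebraMap A K) ≠ 0 :=
    (Polynomial.map_ne_zero_iff (IsFractionRing.injective A K)).2 hf.ne_zero
  intro x hx
  have hx0 : x ≠ 0 := by
    rintro rfl
    exact hf0 (by simpa using hx)
  obtain ⟨b, hb, hbx⟩ := IsLocalization.integerNormalization_spec (nonZeroDivisors A) x
  set N := IsLocalization.integerNormalization (nonZeroDivisors A) x
  have hb0 : algebraMap A K b ≠ 0 :=
    (map_ne_zero_iff _ (IsFractionRing.injective A K)).2 (nonZeroDivisors.ne_zero hb)
  have hbx' : N.map (algebraMap A K) = C (algebraMap A K b) * x := by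
    rw [hbx, Algebra.smul_def]; rfl
  have hN0 : N ≠ 0 := by
    intro h
    rw [h, Polynomial.map_zero] at hbx'
    exact mul_ne_zero (C_ne_zero.2 hb0) hx0 hbx'.symm
  have hc0 : algebraMap A K N.content ≠ 0 :=
    (map_ne_zero_iff _ (IsFractionRing.injective A K)).2 (by rwa [Ne, content_eq_zero_iff])
  have hassoc : Associated x (N.primPart.map (algebraMap A K)) := by
    have h1 : Associated x (N.map (algebraMap A K)) := by
      rw [hbx']
      exact associated_unit_mul_right x _ ((isUnit_C).2 hb0.isUnit)
    refine h1.trans ?_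
    conv_lhs => rw [N.eq_C_content_mul_primPart]
    rw [Polynomial.map_mul, map_C]
    exact associated_unit_mul_left _ _ ((isUnit_C).2 hc0.isUnit)
  -- Gauss's lemma: a primitive square dividing over the fraction field divides over `A`.
  have hprim := N.isPrimitive_primPart
  have hdvd : N.primPart * N.primPart ∣ f := by
    refine (hprim.mul hprim).dvd_of_fraction_map_dvd_fraction_map (K := K) ?_
    rw [Polynomial.map_mul]
    exact (hassoc.mul_mul hassoc).dvd_iff_dvd_left.1 hx
  exact hassoc.symm.isUnit ((hf _ hdvd).map (mapRingHom (algebraMap A K)))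

theorem disc_ne_zero [IsDomain A] [UniqueFactorizationMonoid A] [CharZero A] {f : A[X]}
    (hf : Squarefree f) : disc f ≠ 0 := by
  have inj := IsFractionRing.injective A (FractionRing A)
  have hsep := PerfectField.separable_iff_squarefree.2 (squarefree_map_fractionRing hf)
  have h := resultant_ne_zero _ _ hsep
  rw [derivative_map, natDegree_map_eq_of_injective inj, natDegree_map_eq_of_injective inj,
    resultant_map_map] at h
  exact fun h0 => h (by rw [show f.resultant (derivative f) = 0 from h0, map_zero])

/-- A ring homomorphism that does not kill the discriminant specialises the polynomial to one
without multiple roots. -/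
theorem eval₂_derivative_ne_zero {B : Type*} [CommRing B] {f : A[X]} (hf : f.natDegree ≠ 0)
    (φ : A →+* B) (y : B) (hd : φ (disc f) ≠ 0) (h : f.eval₂ φ y = 0) :
    (derivative f).eval₂ φ y ≠ 0 := by
  obtain ⟨p, q, -, -, e⟩ := exists_mul_add_mul_eq_C_resultant f (derivative f) le_rfl le_rfl
    (Or.inl hf)
  intro h'
  have := congr_arg (eval₂ φ y) e
  rw [eval₂_add, eval₂_mul, eval₂_mul, h, h', eval₂_C] at this
  exact hd (by simpa [disc] using this.symm)

/-- The mapped resultant keeps its formal degrees; if the leading coefficient dies, `f` and its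
derivative both drop below them, which kills the resultant. -/
theorem map_leadingCoeff_ne_zero {B : Type*} [CommRing B] [CharZero A] [IsDomain A]
    {f : A[X]} (hf : f.natDegree ≠ 0)
    (φ : A →+* B) (hd : φ (disc f) ≠ 0) : φ f.leadingCoeff ≠ 0 := by
  intro h
  apply hd
  have hdeg : (derivative f).natDegree = f.natDegree - 1 := natDegree_derivative f
  rw [disc, ← resultant_map_map]
  have h1 : (f.map φ).natDegree < f.natDegree := by
    refine lt_of_le_of_ne natDegree_map_le fun e => ?_
    have : (f.map φ).leadingCoeff = 0 := by rw [leadingCoeff, e, coeff_map]; exact h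
    rw [leadingCoeff_eq_zero] at this
    rw [this] at e
    exact hf (by simpa using e.symm)
  rcases Nat.eq_zero_or_pos (derivative f).natDegree with h0 | h0
  -- Formal degree 0 cannot drop, but here `f` is linear and its derivative is the leading
  -- coefficient.
  · rw [h0, resultant_zero_right_deg, coeff_map, coeff_derivative]
    have : f.natDegree = 1 := by omega
    rw [leadingCoeff, this] at h
    simp [h, this]
  · refine resultant_eq_zero_of_lt_lt _ _ _ _ h1 ?_
    refine lt_of_le_of_ne natDegree_map_le fun e => ?_
    have h2 : ((derivative f).map φ).coeff (derivative f).natDegree = 0 := by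
      rw [coeff_map, coeff_derivative, hdeg, Nat.sub_add_cancel (by omega), map_mul]
      rw [leadingCoeff] at h
      rw [h, zero_mul]
    rw [← e, ← leadingCoeff, leadingCoeff_eq_zero] at h2
    rw [h2, natDegree_zero] at e
    omega

end Discriminant

/-! ### Zero sets as graphs, and their dimension. -/

section ImplicitFunction

variable {E : Type*} [NormedAddCommGroup E] [NormedSpace ℝ E]

/-- Strict differentiability compares two nearby zeros with each other. An error below half of `|L
(0, 1)|` lets the vertical difference be absorbed and bounded by the horizontal one. -/
theorem exists_dist_le_of_hasStrictFDerivAt {g : E × ℝ → ℝ} {L : E × ℝ →L[ℝ] ℝ} {p : E × ℝ}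
    (hg : HasStrictFDerivAt g L p) (hL : L (0, 1) ≠ 0) :
    ∃ K : NNReal, ∃ U ∈ 𝓝 p, ∀ u ∈ U, ∀ v ∈ U, g u = 0 → g v = 0 →
      dist u v ≤ K * dist u.1 v.1 := by
  set c := |L (0, 1)|
  have hc : 0 < c := abs_pos.2 hL
  have h := hg.isLittleO.def (half_pos hc)
  rw [nhds_prod_eq, eventually_iff_exists_mem] at h
  obtain ⟨W, hW, hWp⟩ := h
  obtain ⟨U₁, hU₁, U₂, hU₂, hUW⟩ := mem_prod_iff.1 hW
  refine ⟨⟨1 + (2 * ‖L‖ + c) / c, by positivity⟩, U₁ ∩ U₂, inter_mem hU₁ hU₂,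
    fun u hu v hv hgu hgv => ?_⟩
  have h := hWp (u, v) (hUW ⟨hu.1, hv.2⟩)
  simp only [hgu, hgv, sub_zero, zero_sub, norm_neg] at h
  set a := u - v with ha
  have hdec : L a = L (a.1, 0) + a.2 * L (0, 1) := by
    rw [← smul_eq_mul, ← map_smul, ← map_add]; simp
  have hna : ‖a‖ ≤ ‖a.1‖ + |a.2| := by
    rw [Prod.norm_def]; exact max_le_add_of_nonneg (norm_nonneg _) (norm_nonneg _)
  have h1 : ‖L (a.1, 0)‖ ≤ ‖L‖ * ‖a.1‖ := by
    have := L.le_opNorm (a.1, 0)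
    rwa [Prod.norm_mk, norm_zero, max_eq_left (norm_nonneg _)] at this
  have h2 : |a.2| * c ≤ ‖L a‖ + ‖L (a.1, 0)‖ := by
    rw [← abs_mul, show a.2 * L (0, 1) = L a - L (a.1, 0) by rw [hdec]; ring]
    exact norm_sub_le (L a) (L (a.1, 0))
  have h3 : |a.2| * c ≤ (2 * ‖L‖ + c) * ‖a.1‖ := by
    nlinarith [norm_nonneg a.1, abs_nonneg a.2]
  have h4 : |a.2| ≤ (2 * ‖L‖ + c) / c * ‖a.1‖ := by
    rw [div_mul_eq_mul_div, le_div_iff₀ hc]; exact h3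
  rw [dist_eq_norm, dist_eq_norm]
  change ‖a‖ ≤ (1 + (2 * ‖L‖ + c) / c) * ‖a.1‖
  linarith

/-- The map `(e, t) ↦ (e, g (e, t))` is a submersion at `p`, so its range contains all nearby `(e,
0)`. -/
theorem image_fst_zeros_mem_nhds [CompleteSpace E] {g : E × ℝ → ℝ} {L : E × ℝ →L[ℝ] ℝ}
    {p : E × ℝ} (hg : HasStrictFDerivAt g L p) (hL : L (0, 1) ≠ 0) (hp : g p = 0) :
    Prod.fst '' {q | g q = 0} ∈ 𝓝 p.1 := by
  have hF : HasStrictFDerivAt (fun q : E × ℝ => (q.1, g q))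
      ((ContinuousLinearMap.fst ℝ E ℝ).prod L) p := hasStrictFDerivAt_fst.prodMk hg
  have hsurj : ((ContinuousLinearMap.fst ℝ E ℝ).prod L).range = ⊤ := by
    rw [LinearMap.range_eq_top]
    rintro ⟨e, t⟩
    refine ⟨(e, (t - L (e, 0)) / L (0, 1)), ?_⟩
    have : L (e, (t - L (e, 0)) / L (0, 1)) = t := by
      have : (e, (t - L (e, 0)) / L (0, 1)) =
          (e, (0 : ℝ)) + ((t - L (e, 0)) / L (0, 1)) • ((0 : E), (1 : ℝ)) := by simp
      rw [this, map_add, map_smul, smul_eq_mul, div_mul_cancel₀ _ hL]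
      ring
    simpa using this
  have hmap := hF.map_nhds_eq_of_surj hsurj
  have hr : range (fun q : E × ℝ => (q.1, g q)) ∈ 𝓝 (p.1, (0 : ℝ)) := by
    rw [← hp, ← hmap]
    exact range_mem_map
  have hcont : Tendsto (fun e : E => (e, (0 : ℝ))) (𝓝 p.1) (𝓝 (p.1, (0 : ℝ))) :=
    (Continuous.prodMk_left (0 : ℝ)).tendsto p.1
  filter_upwards [hcont hr] with e he
  obtain ⟨q, hq⟩ := he
  simp only [Prod.mk.injEq] at hq
  exact ⟨q, hq.2, hq.1⟩

theorem dimH_le_of_forall_nhdsWithin {X : Type*} [EMetricSpace X] [SecondCountableTopology X]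
    {s : Set X} {d : ENNReal} (h : ∀ x ∈ s, ∃ t ∈ 𝓝[s] x, dimH t ≤ d) : dimH s ≤ d := by
  by_contra! hlt
  obtain ⟨x, hx, hxt⟩ := exists_mem_nhdsWithin_lt_dimH_of_lt_dimH hlt
  obtain ⟨t, ht, htd⟩ := h x hx
  exact (hxt t ht).not_ge htd

theorem dimH_le_image_fst [SecondCountableTopology E] {g : E × ℝ → ℝ} {T : Set (E × ℝ)}
    (hT : ∀ p ∈ T, g p = 0 ∧ ∃ L : E × ℝ →L[ℝ] ℝ, HasStrictFDerivAt g L p ∧ L (0, 1) ≠ 0) :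
    dimH T ≤ dimH (Prod.fst '' T) := by
  refine dimH_le_of_forall_nhdsWithin fun p hp => ?_
  obtain ⟨-, L, hL, hL'⟩ := hT p hp
  obtain ⟨K, U, hU, hUK⟩ := exists_dist_le_of_hasStrictFDerivAt hL hL'
  refine ⟨U ∩ T, inter_mem (mem_nhdsWithin_of_mem_nhds hU) self_mem_nhdsWithin, ?_⟩
  let f : ↥(U ∩ T) → E := fun q => q.1.1
  have hf : AntilipschitzWith K f := AntilipschitzWith.of_le_mul_dist fun u v =>
    hUK u u.2.1 v v.2.1 (hT u u.2.2).1 (hT v v.2.2).1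
  calc dimH (U ∩ T) = dimH (univ : Set ↥(U ∩ T)) := by
        rw [← (isometry_subtype_coe (s := U ∩ T)).dimH_image, image_univ, Subtype.range_coe]
    _ ≤ dimH (f '' univ) := hf.le_dimH_image _
    _ ≤ dimH (Prod.fst '' T) := dimH_mono (by rintro _ ⟨q, -, rfl⟩; exact ⟨q, q.2.2, rfl⟩)

end ImplicitFunction

/-! ### Zeros of polynomials with varying coefficients. -/

section PolynomialFamily

variable {E : Type*} [NormedAddCommGroup E] [NormedSpace ℝ E] {A : Type*} [CommRing A]
  {φ : E → A →+* ℝ}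

theorem contDiff_eval₂ (hφ : ∀ a, ContDiff ℝ 1 fun e => φ e a) (F : A[X]) :
    ContDiff ℝ 1 fun p : E × ℝ => F.eval₂ (φ p.1) p.2 := by
  simp only [eval₂_eq_sum_range]
  exact ContDiff.sum fun i _ => ((hφ _).comp contDiff_fst).mul (contDiff_snd.pow i)

theorem exists_hasStrictFDerivAt_eval₂ (hφ : ∀ a, ContDiff ℝ 1 fun e => φ e a) (F : A[X])
    (p : E × ℝ) : ∃ L : E × ℝ →L[ℝ] ℝ,
      HasStrictFDerivAt (fun q : E × ℝ => F.eval₂ (φ q.1) q.2) L p ∧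
        L (0, 1) = (derivative F).eval₂ (φ p.1) p.2 := by
  have h := (contDiff_eval₂ hφ F).contDiffAt.hasStrictFDerivAt (x := p) one_ne_zero
  refine ⟨_, h, ?_⟩
  have hline : HasDerivAt (fun y : ℝ => (p.1, y)) ((0 : E), (1 : ℝ)) p.2 :=
    (hasDerivAt_const p.2 p.1).prodMk (hasDerivAt_id p.2)
  have h1 := h.hasFDerivAt.comp_hasDerivAt p.2 hline
  have h2 := (F.map (φ p.1)).hasDerivAt p.2
  have h3 : (fun q : E × ℝ => F.eval₂ (φ q.1) q.2) ∘ (fun y : ℝ => (p.1, y)) =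
      fun y => (F.map (φ p.1)).eval y := by
    funext y; simp [eval_map]
  rw [h3] at h1
  rw [h1.unique h2, derivative_map, eval_map]

/-- Multiple roots are allowed: each point of `T` is a simple zero of some iterated derivative,
which splits `T` into countably many pieces of graphs. -/
theorem dimH_eval₂_le_image_fst [SecondCountableTopology E]
    (hφ : ∀ a, ContDiff ℝ 1 fun e => φ e a) (F : A[X]) {T : Set (E × ℝ)}
    (hT : ∀ p ∈ T, F.eval₂ (φ p.1) p.2 = 0) (hF : ∀ p ∈ T, F.map (φ p.1) ≠ 0) :
    dimH T ≤ dimH (Prod.fst '' T) := by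
  let Tk : ℕ → Set (E × ℝ) := fun k => {p ∈ T | (derivative^[k] F).eval₂ (φ p.1) p.2 = 0 ∧
    (derivative^[k + 1] F).eval₂ (φ p.1) p.2 ≠ 0}
  have hcover : T ⊆ ⋃ k, Tk k := by
    intro p hp
    have hroot : (F.map (φ p.1)).IsRoot p.2 := by rw [IsRoot, eval_map]; exact hT p hp
    have hex : ∃ n, (derivative^[n] F).eval₂ (φ p.1) p.2 ≠ 0 := by
      by_contra! hall
      have := (lt_rootMultiplicity_iff_isRoot_iterate_derivative (hF p hp)
        (n := (F.map (φ p.1)).rootMultiplicity p.2) (t := p.2)).2 fun m _ => by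
          rw [IsRoot, iterate_derivative_map, eval_map]; exact hall m
      exact lt_irrefl _ this
    classical
    have hmin := Nat.find_spec hex
    obtain ⟨k, hk⟩ : ∃ k, Nat.find hex = k + 1 := by
      refine Nat.exists_eq_succ_of_ne_zero fun h0 => ?_
      rw [h0] at hmin
      exact hmin (hT p hp)
    refine mem_iUnion.2 ⟨k, hp, ?_, hk ▸ hmin⟩
    exact not_not.1 (Nat.find_min hex (m := k) (by omega))
  calc dimH T ≤ dimH (⋃ k, Tk k) := dimH_mono hcover
    _ = ⨆ k, dimH (Tk k) := dimH_iUnion _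
    _ ≤ dimH (Prod.fst '' T) := iSup_le fun k => by
      refine (dimH_le_image_fst (g := fun q => (derivative^[k] F).eval₂ (φ q.1) q.2)
        fun p hp => ⟨hp.2.1, ?_⟩).trans (dimH_mono (image_mono fun p hp => hp.1))
      obtain ⟨L, hL, hL'⟩ := exists_hasStrictFDerivAt_eval₂ hφ (derivative^[k] F) p
      exact ⟨L, hL, by rw [hL', ← Function.iterate_succ_apply' derivative]; exact hp.2.2⟩

theorem image_fst_eval₂_zeros_mem_nhds [CompleteSpace E]
    (hφ : ∀ a, ContDiff ℝ 1 fun e => φ e a) (F : A[X]) {e : E} {y : ℝ}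
    (h : F.eval₂ (φ e) y = 0) (h' : (derivative F).eval₂ (φ e) y ≠ 0) :
    Prod.fst '' {q : E × ℝ | F.eval₂ (φ q.1) q.2 = 0} ∈ 𝓝 e := by
  obtain ⟨L, hL, hL'⟩ := exists_hasStrictFDerivAt_eval₂ hφ F (e, y)
  exact image_fst_zeros_mem_nhds hL (hL' ▸ h') h

theorem dimH_image_le_of_contDiff {V W : Type*} [NormedAddCommGroup V] [NormedSpace ℝ V]
    [FiniteDimensional ℝ V] [NormedAddCommGroup W] [NormedSpace ℝ W] {f : V → W}
    (hf : ContDiff ℝ 1 f) (s : Set V) : dimH (f '' s) ≤ dimH s :=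
  hf.contDiffOn.dimH_image_le convex_univ (subset_univ s)

theorem contDiff_evalRingHom (a : ℝ[X]) : ContDiff ℝ 1 fun u : ℝ => evalRingHom u a := by
  simpa using a.contDiff_aeval (𝕜 := ℝ) 1

/-- A plane algebraic curve has dimension at most one. -/
theorem dimH_planeCurve_le {H : ℝ[X][X]} (hH : H ≠ 0) :
    dimH {p : ℝ × ℝ | H.eval₂ (evalRingHom p.1) p.2 = 0} ≤ 1 := by
  obtain ⟨n, hn⟩ : ∃ n, H.coeff n ≠ 0 := by
    by_contra! h
    exact hH (ext fun n => by simp [h n])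
  let T : Set (ℝ × ℝ) := {p | H.eval₂ (evalRingHom p.1) p.2 = 0 ∧ H.map (evalRingHom p.1) ≠ 0}
  -- Vertical lines inside the curve lie over roots of a nonzero coefficient, so they are finitely
  -- many.
  have hsub : {p : ℝ × ℝ | H.eval₂ (evalRingHom p.1) p.2 = 0} ⊆
      T ∪ ⋃ u ∈ ((H.coeff n).roots.toFinset : Set ℝ), (fun v : ℝ => (u, v)) '' univ := by
    rintro ⟨u, v⟩ huv
    by_cases hu : H.map (evalRingHom u) = 0
    · refine Or.inr (mem_iUnion₂.2 ⟨u, ?_, v, mem_univ v, rfl⟩)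
      have : (H.map (evalRingHom u)).coeff n = 0 := by rw [hu, coeff_zero]
      simpa [hn] using this
    · exact Or.inl ⟨huv, hu⟩
  refine (dimH_mono hsub).trans ?_
  rw [dimH_union]
  refine max_le ?_ ?_
  · refine (dimH_eval₂_le_image_fst contDiff_evalRingHom H (fun p hp => hp.1)
      fun p hp => hp.2).trans ?_
    exact (dimH_mono (subset_univ _)).trans_eq Real.dimH_univ
  · rw [dimH_bUnion (Finset.countable_toSet _)]
    refine iSup₂_le fun u _ => ?_
    exact (dimH_image_le_of_contDiff (contDiff_const.prodMk contDiff_id) _).trans_eq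
      Real.dimH_univ

end PolynomialFamily

/-- Evaluation of elements of `ℝ[z][x]` at a point `(x, z)`. -/
noncomputable def evalXZ (p : ℝ × ℝ) : ℝ[X][X] →+* ℝ :=
  (evalRingHom p.2).comp (evalRingHom (C p.1))

theorem evalXZ_eq_eval_map (x z : ℝ) (G : ℝ[X][X]) :
    evalXZ (x, z) G = (G.map (evalRingHom z)).eval x := by
  rw [eval_map]
  change evalRingHom z (G.eval (C x)) = _
  rw [← eval₂_id, hom_eval₂]
  simp

theorem contDiff_evalXZ (G : ℝ[X][X]) : ContDiff ℝ 1 fun p : ℝ × ℝ => evalXZ p G := by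
  have h := (contDiff_eval₂ contDiff_evalRingHom G).comp (contDiff_snd.prodMk contDiff_fst)
  convert h using 1
  funext p
  rw [show p = (p.1, p.2) from rfl, evalXZ_eq_eval_map, eval_map]
  rfl

theorem value_eq_eval₂ (F : Poly3) (x y z : ℝ) : value F x y z = F.eval₂ (evalXZ (x, z)) y := by
  change evalXZ (x, z) (F.eval (C (C y))) = _
  rw [← eval₂_id, hom_eval₂]
  simp [evalXZ]

/-- The restriction of `F` to the plane `z = a`, as a polynomial in `ℝ[x][y]`. -/
noncomputable def slice (F : Poly3) (a : ℝ) : ℝ[X][X] :=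
  F.map (mapRingHom (evalRingHom a))

/-- Otherwise z - a would divide every coefficient of `F`. -/
theorem slice_ne_zero {F : Poly3}
    (hz : ∀ p : ℝ[X], C (C p) ∣ F → p.natDegree = 0) (a : ℝ) : slice F a ≠ 0 := by
  intro h
  have : C (C (X - C a)) ∣ F := by
    refine (C_dvd_iff_dvd_coeff _ _).2 fun i => (C_dvd_iff_dvd_coeff _ _).2 fun j => ?_
    have := congr_arg (fun H : ℝ[X][X] => (H.coeff i).coeff j) h
    simp only [slice, coeff_map, coe_mapRingHom, coeff_zero] at this
    exact dvd_iff_isRoot.2 this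
  simpa using hz _ this

theorem value_eq_eval₂_slice (F : Poly3) (x y a : ℝ) :
    value F x y a = (slice F a).eval₂ (evalRingHom x) y := by
  rw [value_eq_eval₂, slice, eval₂_map]
  congr 1
  ext G <;> simp [evalXZ]

section Space

variable {V : Type*} [NormedAddCommGroup V] [NormedSpace ℝ V] {f g h : V → ℝ}

theorem contDiff_vec3 (hf : ContDiff ℝ 1 f) (hg : ContDiff ℝ 1 g) (hh : ContDiff ℝ 1 h) :
    ContDiff ℝ 1 fun v => (!₂[f v, g v, h v] : EuclideanSpace ℝ (Fin 3)) := by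
  rw [contDiff_euclidean]
  intro i
  fin_cases i
  · simpa using hf
  · simpa using hg
  · simpa using hh

theorem vec3_eta (p : EuclideanSpace ℝ (Fin 3)) : !₂[p 0, p 1, p 2] = p := by
  ext i
  fin_cases i <;> simp

theorem contDiff_coord (i : Fin 3) : ContDiff ℝ 1 fun p : EuclideanSpace ℝ (Fin 3) => p i :=
  contDiff_euclidean.1 contDiff_id i

end Space

/-! ### Dimensions of level curves and surface; the two criteria. -/

theorem dimH_levelCurve_le {F : Poly3} {a : ℝ} (hF : slice F a ≠ 0) :
    dimH (levelCurve F a) ≤ 1 := by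
  have hsub : levelCurve F a ⊆ (fun p : ℝ × ℝ => !₂[p.1, p.2, a]) ''
      {p : ℝ × ℝ | (slice F a).eval₂ (evalRingHom p.1) p.2 = 0} := by
    rintro p ⟨hp, hpa⟩
    refine ⟨(p 0, p 1), ?_, ?_⟩
    · have : value F (p 0) (p 1) (p 2) = 0 := hp
      rwa [hpa, value_eq_eval₂_slice] at this
    · simpa only [hpa] using vec3_eta p
  exact (dimH_mono hsub).trans ((dimH_image_le_of_contDiff
    (contDiff_vec3 contDiff_fst contDiff_snd contDiff_const) _).trans (dimH_planeCurve_le hF))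

theorem dimH_biUnion_levelCurve_le {F : Poly3} (hF : ∀ a, slice F a ≠ 0) {A : Set ℝ}
    (hA : A.Finite) : dimH (⋃ a ∈ A, levelCurve F a) ≤ 1 := by
  rw [dimH_bUnion hA.countable]
  exact iSup₂_le fun a _ => dimH_levelCurve_le (hF a)

theorem isRealLevelCurve_of_image_mem_nhds {F : Poly3} {a : ℝ} (hF : slice F a ≠ 0)
    {f : EuclideanSpace ℝ (Fin 3) → ℝ} (hf : ContDiff ℝ 1 f) {t : ℝ}
    (h : f '' levelCurve F a ∈ 𝓝 t) : IsRealLevelCurve F a := by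
  refine le_antisymm (dimH_levelCurve_le hF) ?_
  calc (1 : ENNReal) = dimH (f '' levelCurve F a) := by
        rw [Real.dimH_of_mem_nhds h, Module.finrank_self, Nat.cast_one]
    _ ≤ _ := dimH_image_le_of_contDiff hf _

theorem two_le_dimH_surface_of_image_mem_nhds {F : Poly3}
    {f : EuclideanSpace ℝ (Fin 3) → ℝ × ℝ} (hf : ContDiff ℝ 1 f) {t : ℝ × ℝ}
    (h : f '' surface F ∈ 𝓝 t) : 2 ≤ dimH (surface F) := by
  calc (2 : ENNReal) = dimH (f '' surface F) := by
        rw [Real.dimH_of_mem_nhds h]; simp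
    _ ≤ _ := dimH_image_le_of_contDiff hf _

theorem surface_subset_of_levelCurves (F : Poly3) (A : Set ℝ) :
    surface F ⊆ (⋃ a ∈ A, levelCurve F a) ∪ {p ∈ surface F | p 2 ∉ A} := by
  intro p hp
  by_cases h : p 2 ∈ A
  · exact Or.inl (mem_iUnion₂.2 ⟨p 2, h, hp, rfl⟩)
  · exact Or.inr ⟨hp, h⟩

theorem infinite_of_isRealLevelCurve {F : Poly3} {a : ℝ} (h : IsRealLevelCurve F a) :
    (levelCurve F a).Infinite := by
  intro hfin
  have : dimH (levelCurve F a) = 1 := h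
  rw [hfin.dimH_zero] at this
  exact zero_ne_one this

/-- The criterion for surfaces on which the vertical direction `y` is not constant. The polynomial
`M` controls the multiple roots with respect to `y`. -/
theorem isRealSurface_iff_of_generic {F : Poly3} {M : ℝ[X][X]} {A : Set ℝ} (hA : A.Finite)
    (hF : ∀ a, slice F a ≠ 0) (hM : M ≠ 0) (hMA : ∀ a ∉ A, M.map (evalRingHom a) ≠ 0)
    (hFA : ∀ a ∉ A, ∀ x, F.map (evalXZ (x, a)) ≠ 0)
    (hreg : ∀ x y z, evalXZ (x, z) M ≠ 0 → F.eval₂ (evalXZ (x, z)) y = 0 →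
      (derivative F).eval₂ (evalXZ (x, z)) y ≠ 0) :
    IsRealSurface F ↔ ∃ a : ℝ, a ∉ A ∧ IsRealLevelCurve F a := by
  let T : Set ((ℝ × ℝ) × ℝ) := {q | F.eval₂ (evalXZ q.1) q.2 = 0 ∧ q.1.2 ∉ A}
  let ι : (ℝ × ℝ) × ℝ → EuclideanSpace ℝ (Fin 3) := fun q => !₂[q.1.1, q.2, q.1.2]
  have hι : ContDiff ℝ 1 ι := contDiff_vec3 (contDiff_fst.comp contDiff_fst) contDiff_snd
    (contDiff_snd.comp contDiff_fst)
  have hcover : surface F ⊆ (⋃ a ∈ A, levelCurve F a) ∪ ι '' T := by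
    refine (surface_subset_of_levelCurves F A).trans (union_subset_union_right _ ?_)
    rintro p ⟨hp, hpA⟩
    have hp : value F (p 0) (p 1) (p 2) = 0 := hp
    rw [value_eq_eval₂] at hp
    exact ⟨((p 0, p 2), p 1), ⟨hp, hpA⟩, vec3_eta p⟩
  have hTdim : dimH T ≤ dimH (Prod.fst '' T) := dimH_eval₂_le_image_fst contDiff_evalXZ F
    (fun q hq => hq.1) fun q hq => hFA q.1.2 hq.2 q.1.1
  have hSdim : dimH (surface F) ≤ max 1 (dimH (Prod.fst '' T)) := by
    refine (dimH_mono hcover).trans ?_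
    rw [dimH_union]
    exact max_le_max (dimH_biUnion_levelCurve_le hF hA)
      ((dimH_image_le_of_contDiff hι T).trans hTdim)
  constructor
  · intro hS
    by_contra! hno
    -- A point with M ≠ 0 would give an arc of the level curve, by solving for y along x with a
    -- fixed.
    have hsub : Prod.fst '' T ⊆
        Prod.swap '' {q : ℝ × ℝ | M.eval₂ (evalRingHom q.1) q.2 = 0} := by
      rintro _ ⟨⟨⟨x, a⟩, y⟩, ⟨hy, ha⟩, rfl⟩
      refine ⟨(a, x), ?_, rfl⟩
      by_contra hMxa
      have hMxa : evalXZ (x, a) M ≠ 0 := by rwa [evalXZ_eq_eval_map, eval_map]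
      have hn := image_fst_eval₂_zeros_mem_nhds (φ := fun x : ℝ => evalXZ (x, a))
        (fun G => (contDiff_evalXZ G).comp (contDiff_id.prodMk contDiff_const)) F hy
        (hreg x y a hMxa hy)
      refine hno a ha (isRealLevelCurve_of_image_mem_nhds (hF a) (contDiff_coord 0)
        (mem_of_superset hn ?_))
      rintro _ ⟨⟨x', y'⟩, hq, rfl⟩
      refine ⟨!₂[x', y', a], ⟨?_, by simp⟩, by simp⟩
      change value F _ _ _ = 0
      simpa [value_eq_eval₂] using hq
    have h1 : dimH (Prod.fst '' T) ≤ 1 := (dimH_mono hsub).trans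
      ((dimH_image_le_of_contDiff (contDiff_snd.prodMk contDiff_fst) _).trans
        (dimH_planeCurve_le hM))
    have h2 : (2 : ENNReal) ≤ 1 := by
      rw [← show dimH (surface F) = 2 from hS]
      exact hSdim.trans (max_le le_rfl h1)
    exact absurd h2 (by norm_num)
  · rintro ⟨a, ha, hreal⟩
    refine le_antisymm (hSdim.trans (max_le (by norm_num) ?_)) ?_
    · refine (dimH_mono (subset_univ _)).trans ?_
      rw [Real.dimH_univ_eq_finrank]
      simp
    -- Over the finitely many roots of M(·, a) lie finitely many points, but a real level curve is
    -- infinite.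
    · have hex : ∃ p ∈ levelCurve F a, evalXZ (p 0, a) M ≠ 0 := by
        by_contra! hall
        refine infinite_of_isRealLevelCurve hreal ?_
        have hfin : (⋃ x ∈ ((M.map (evalRingHom a)).roots.toFinset : Set ℝ),
            (fun y : ℝ => (!₂[x, y, a] : EuclideanSpace ℝ (Fin 3))) ''
              ((F.map (evalXZ (x, a))).roots.toFinset : Set ℝ)).Finite :=
          (Finset.finite_toSet _).biUnion fun x _ => (Finset.finite_toSet _).image _
        refine hfin.subset fun p hp => ?_
        have hpa : p 2 = a := hp.2
        have hpF : value F (p 0) (p 1) (p 2) = 0 := hp.1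
        rw [hpa, value_eq_eval₂] at hpF
        refine mem_iUnion₂.2 ⟨p 0, ?_, p 1, ?_, ?_⟩
        · have := hall p hp
          rw [evalXZ_eq_eval_map] at this
          simpa [hMA a ha] using this
        · simpa [hFA a ha, eval_map] using hpF
        · simpa only [hpa] using vec3_eta p
      obtain ⟨p, ⟨hp, hpa⟩, hpM⟩ := hex
      have hp : value F (p 0) (p 1) (p 2) = 0 := hp
      rw [hpa, value_eq_eval₂] at hp
      have hn := image_fst_eval₂_zeros_mem_nhds contDiff_evalXZ F hp (hreg _ _ _ hpM hp)
      refine two_le_dimH_surface_of_image_mem_nhds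
        ((contDiff_coord 0).prodMk (contDiff_coord 2)) (mem_of_superset hn ?_)
      rintro _ ⟨q, hq, rfl⟩
      refine ⟨ι q, ?_, by simp [ι]⟩
      change value F _ _ _ = 0
      simpa [value_eq_eval₂, ι] using hq

theorem map_evalRingHom_ne_zero_of_slice {G : ℝ[X][X]} {a : ℝ} (h : slice (C G) a ≠ 0) :
    G.map (evalRingHom a) ≠ 0 := by
  intro h0
  exact h (by rw [slice, map_C, coe_mapRingHom, h0, C_0])

/-- The criterion for cylinders in the direction of `y`. -/
theorem isRealSurface_iff_of_cylinder {G : ℝ[X][X]} {A : Set ℝ} (hA : A.Finite)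
    (hF : ∀ a, slice (C G) a ≠ 0)
    (hreg : ∀ a ∉ A, ∀ x, G.eval₂ (evalRingHom a) x = 0 →
      (derivative G).eval₂ (evalRingHom a) x ≠ 0) :
    IsRealSurface (C G) ↔ ∃ a : ℝ, a ∉ A ∧ IsRealLevelCurve (C G) a := by
  have hval : ∀ x y z, value (C G) x y z = G.eval₂ (evalRingHom z) x := fun x y z => by
    rw [value_eq_eval₂, eval₂_C, evalXZ_eq_eval_map, eval_map]
  let φ : ℝ × ℝ → ℝ[X] →+* ℝ := fun q => evalRingHom q.2
  have hφ : ∀ a, ContDiff ℝ 1 fun q => φ q a := fun a =>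
    (contDiff_evalRingHom a).comp contDiff_snd
  let T : Set ((ℝ × ℝ) × ℝ) := {q | G.eval₂ (φ q.1) q.2 = 0}
  let ι : (ℝ × ℝ) × ℝ → EuclideanSpace ℝ (Fin 3) := fun q => !₂[q.2, q.1.1, q.1.2]
  have hι : ContDiff ℝ 1 ι := contDiff_vec3 contDiff_snd (contDiff_fst.comp contDiff_fst)
    (contDiff_snd.comp contDiff_fst)
  constructor
  · intro hS
    by_contra! hno
    have hsub : surface (C G) ⊆ ⋃ a ∈ A, levelCurve (C G) a := by
      intro p hp
      by_cases hpA : p 2 ∈ A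
      · exact mem_iUnion₂.2 ⟨p 2, hpA, hp, rfl⟩
      · have hp : value (C G) (p 0) (p 1) (p 2) = 0 := hp
        rw [hval] at hp
        -- The line through the point parallel to the y-axis stays in the level curve.
        refine absurd (isRealLevelCurve_of_image_mem_nhds (hF _) (contDiff_coord 1) (t := 0)
          (mem_of_superset univ_mem fun y _ => ?_)) (hno _ hpA)
        refine ⟨!₂[p 0, y, p 2], ⟨?_, by simp⟩, by simp⟩
        change value (C G) _ _ _ = 0
        simpa [hval] using hp
    have h2 : (2 : ENNReal) ≤ 1 := by
      rw [← show dimH (surface (C G)) = 2 from hS]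
      exact (dimH_mono hsub).trans (dimH_biUnion_levelCurve_le hF hA)
    exact absurd h2 (by norm_num)
  · rintro ⟨a, ha, hreal⟩
    refine le_antisymm ?_ ?_
    · have hsub : surface (C G) ⊆ ι '' T := by
        intro p hp
        have hp : value (C G) (p 0) (p 1) (p 2) = 0 := hp
        rw [hval] at hp
        exact ⟨((p 1, p 2), p 0), hp, vec3_eta p⟩
      refine (dimH_mono hsub).trans ((dimH_image_le_of_contDiff hι T).trans ?_)
      refine (dimH_eval₂_le_image_fst hφ G (fun q hq => hq) fun q _ =>
        map_evalRingHom_ne_zero_of_slice (hF q.1.2)).trans ?_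
      refine (dimH_mono (subset_univ _)).trans ?_
      rw [Real.dimH_univ_eq_finrank]
      simp
    · obtain ⟨p, hp, hpa⟩ := (infinite_of_isRealLevelCurve hreal).nonempty
      have hp : value (C G) (p 0) (p 1) (p 2) = 0 := hp
      rw [hval, hpa] at hp
      have hn := image_fst_eval₂_zeros_mem_nhds hφ G (e := (p 1, a)) hp (hreg a ha _ hp)
      refine two_le_dimH_surface_of_image_mem_nhds
        ((contDiff_coord 1).prodMk (contDiff_coord 2)) (mem_of_superset hn ?_)
      rintro _ ⟨q, hq, rfl⟩
      refine ⟨ι q, ?_, by simp [ι]⟩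
      change value (C G) _ _ _ = 0
      simpa [hval, ι] using hq

/-! ### What avoiding the critical set guarantees. -/

theorem polyM_ne_zero {F : Poly3} (hdeg : F.natDegree ≠ 0) : polyM F ≠ 0 := by
  rw [polyM, if_neg hdeg]
  exact UniqueFactorizationMonoid.radical_ne_zero

theorem finite_criticalSet {F : Poly3} (hdeg : F.natDegree ≠ 0) : (criticalSet F).Finite := by
  have hM := polyM_ne_zero hdeg
  rw [criticalSet]
  split_ifs with hR
  · exact finite_setOfPred_isRoot hR
  -- M is square-free, so R vanishes identically only when deg_x M = 0.
  · refine finite_setOfPred_isRoot fun h0 => hR ?_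
    rw [polyR]
    split_ifs with hd
    · exact absurd (by rw [eq_C_of_natDegree_eq_zero hd, h0, C_0]) hM
    · rw [polyM, if_neg hdeg]
      exact disc_ne_zero UniqueFactorizationMonoid.squarefree_radical

/-- If M(·, a) = 0, then M and its x-derivative vanish together over a, at x = 0 say, which forces
R(a) = 0. -/
theorem polyM_map_ne_zero {F : Poly3} (hdeg : F.natDegree ≠ 0) {a : ℝ}
    (ha : a ∉ criticalSet F) : (polyM F).map (evalRingHom a) ≠ 0 := by
  have hM := polyM_ne_zero hdeg
  intro h
  rw [criticalSet] at ha
  split_ifs at ha with hR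
  · have hd : (polyM F).natDegree ≠ 0 := fun hd => hR (by rw [polyR, if_pos hd])
    rw [polyR, if_neg hd] at ha
    refine eval₂_derivative_ne_zero hd (evalRingHom a) 0 ha ?_ ?_
    · rw [← eval_map, h, eval_zero]
    · rw [← eval_map, ← derivative_map, h, derivative_zero, eval_zero]
  · refine ha ?_
    have := congr_arg (fun p : ℝ[X] => p.coeff 0) h
    simpa using this

end LevelCurves

open LevelCurves in
theorem theorem2 (F : LevelCurves.Poly3)
    (hsq : Squarefree F)
    (hz : ∀ p : Polynomial ℝ, Polynomial.C (Polynomial.C p) ∣ F → p.natDegree = 0)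
    (hlc : 0 < F.natDegree → F.leadingCoeff.natDegree = 0) :
    LevelCurves.IsRealSurface F ↔
      ∃ a : ℝ, a ∉ LevelCurves.criticalSet F ∧ LevelCurves.IsRealLevelCurve F a := by
  by_cases hdeg : F.natDegree = 0
  · obtain ⟨G, rfl⟩ := natDegree_eq_zero.1 hdeg
    have hcrit : criticalSet (C G) = {a | (disc G).IsRoot a} := by
      simp [criticalSet, polyR, polyM]
    have hG : Squarefree G := fun x hx => isUnit_C.1 (hsq (C x) (by
      rw [← C_mul]; exact map_dvd C hx))
    rw [hcrit]
    refine isRealSurface_iff_of_cylinder (finite_setOfPred_isRoot (disc_ne_zero hG)) (slice_ne_zero hz)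
      fun a ha x hx => ?_
    -- For deg_x G = 0 the discriminant says nothing about roots; instead, G has none because z - a
    -- does not divide it.
    by_cases hGd : G.natDegree = 0
    · exfalso
      have hne := map_evalRingHom_ne_zero_of_slice (slice_ne_zero hz a)
      obtain ⟨c, rfl⟩ := natDegree_eq_zero.1 hGd
      rw [eval₂_C] at hx
      exact hne (by rw [map_C, hx, C_0])
    · exact eval₂_derivative_ne_zero hGd _ x ha hx
  · have hM : polyM F = UniqueFactorizationMonoid.radical (disc F) := by
      rw [polyM, if_neg hdeg]
    -- D_y(F) divides a power of M, so it is nonzero wherever M is.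
    obtain ⟨n, hn⟩ := UniqueFactorizationMonoid.exists_dvd_radical_self_pow (disc_ne_zero hsq)
    rw [← hM] at hn
    refine isRealSurface_iff_of_generic (finite_criticalSet hdeg) (slice_ne_zero hz)
      (polyM_ne_zero hdeg) (fun a ha => polyM_map_ne_zero hdeg ha) (fun a ha x h => ?_)
      fun x y z hMxz => eval₂_derivative_ne_zero hdeg _ y fun h => ?_
    · have hd : mapRingHom (evalRingHom a) (disc F) ≠ 0 := by
        intro h
        have := map_dvd (mapRingHom (evalRingHom a)) hn
        rw [h, map_pow, zero_dvd_iff] at this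
        exact polyM_map_ne_zero hdeg ha (eq_zero_of_pow_eq_zero this)
      refine map_leadingCoeff_ne_zero hdeg _ hd ?_
      -- The leading coefficient is free of x, so vanishing at one (x, a) means vanishing on all of
      -- z = a.
      have h0 : evalXZ (x, a) F.leadingCoeff = 0 := by
        rw [leadingCoeff, ← coeff_map, h, coeff_zero]
      rw [eq_C_of_natDegree_eq_zero (hlc (Nat.pos_of_ne_zero hdeg))] at h0 ⊢
      rw [evalXZ_eq_eval_map, map_C, eval_C] at h0
      rw [coe_mapRingHom, map_C, h0, C_0]
    · have := map_dvd (evalXZ (x, z)) hn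
      rw [h, map_pow, zero_dvd_iff] at this
      exact hMxz (eq_zero_of_pow_eq_zero this)
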